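/- Let $p$ be a prime and let $F/\mathbb{Q}_p$ be a finite extension with valuation ring $\mathcal{O}$, maximal ideal $\mathfrak{m}$ and residue field $k = \mathcal{O}/\mathfrak{m}$. Define $e$ and $f$ by $p\mathcal{O} = \mathfrak{m}^e$ and $q := \# k = p^f$. Let $E$ be a field extension of $k$. For $r \in \mathbb{Z}/(q-1)\mathbb{Z}$, let $r_0, \dots, r_{f-1} \in \{0, \dots, p-1\}$ be the base $p$ digits of $r$, that is, the unique such integers, not all zero, with $r \equiv \sum_{i=0}^{f-1} r_i p^i \pmod{q-1}$. Let $B$ be the subgroup of upper triangular matrices in $\mathrm{GL}_2(\mathcal{O}/\mathfrak{m}^2)$, let $\chi_r : B \to k^\times$ be the character $\begin{pmatrix} a & b \\ 0 & d \end{pmatrix} \mapsto (d \bmod \mathfrak{m})^r$, and let $V_{2,r} = \mathrm{Ind}_{B}^{\mathrm{GL}_2(\mathcal{O}/\mathfrak{m}^2)} \chi_r$ be the principal series over $E$: the $E$-vector space of functions $\varphi : \mathrm{GL}_2(\mathcal{O}/\mathfrak{m}^2) \to E$ satisfying $\varphi(bg) = \chi_r(b)\varphi(g)$ for all $b \in B$,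 on which $\mathrm{GL}_2(\mathcal{O}/\mathfrak{m}^2)$ acts by right translation. Suppose that $e \geq 2$ and $f \geq 2$, i.e. that $F/\mathbb{Q}_p$ is ramified but not totally ramified, that $1 \leq r_i \leq p-2$ for all $0 \leq i \leq f-1$, and that $E$ is infinite. Then $V_{2,r}$ has infinitely many $\mathrm{GL}_2(\mathcal{O}/\mathfrak{m}^2)$-submodules (that is, $\mathrm{GL}_2(\mathcal{O}/\mathfrak{m}^2)$-stable $E$-subspaces). -/

import Mathlib

/-! ### The valuation ring of a finite extension of `ℚ_p` -/

/-- The valuation ring `𝒪` of an algebraic (in particular, of a finite) extension `F / ℚ_p`: the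
elements of absolute value at most `1`, for the unique extension to `F` of the `p`-adic absolute
value (the spectral norm). -/
noncomputable def padicValuationRing (p : ℕ) [Fact p.Prime] (F : Type*) [Field F] [Algebra ℚ_[p] F]
    [Algebra.IsAlgebraic ℚ_[p] F] : ValuationSubring F where
  carrier := {x | spectralMulAlgNorm ℚ_[p] F x ≤ 1}
  zero_mem' := by simp
  one_mem' := by simp
  mul_mem' {x y} hx hy := by
    simp only [Set.mem_ofPred_eq, map_mul] at hx hy ⊢
    exact mul_le_one₀ hx (apply_nonneg _ y) hy
  add_mem' {x y} hx hy := by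
    simp only [Set.mem_ofPred_eq] at hx hy ⊢
    exact (isNonarchimedean_spectralNorm (K := ℚ_[p]) (L := F) x y).trans (max_le hx hy)
  neg_mem' {x} hx := by
    simp only [Set.mem_ofPred_eq, map_neg_eq_map] at hx ⊢
    exact hx
  mem_or_inv_mem' x := by
    simp only [Set.mem_ofPred_eq]
    rcases le_total (spectralMulAlgNorm ℚ_[p] F x) 1 with h | h
    · exact Or.inl h
    · refine Or.inr ?_
      have hx : x ≠ 0 := by
        rintro rfl
        rw [map_zero] at h
        exact absurd h (by norm_num)
      have hmul : spectralMulAlgNorm ℚ_[p] F x * spectralMulAlgNorm ℚ_[p] F x⁻¹ = 1 := by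
        rw [← map_mul, mul_inv_cancel₀ hx, map_one]
      calc spectralMulAlgNorm ℚ_[p] F x⁻¹
          ≤ spectralMulAlgNorm ℚ_[p] F x * spectralMulAlgNorm ℚ_[p] F x⁻¹ :=
            le_mul_of_one_le_left (apply_nonneg _ _) h
        _ = 1 := hmul

/-! ### The Borel subgroup of `GL₂` -/

/-- The subgroup `B(R)` of upper triangular matrices in `GL₂(R)`. -/
def borelGL2 (R : Type*) [CommRing R] : Subgroup (GL (Fin 2) R) where
  carrier := {g | g.val 1 0 = 0}
  one_mem' := by simp
  mul_mem' {g h} hg hh := by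
    simp only [Set.mem_ofPred_eq] at hg hh ⊢
    simp [Matrix.mul_apply, Fin.sum_univ_two, hg, hh]
  inv_mem' {g} hg := by
    simp only [Set.mem_ofPred_eq] at hg ⊢
    rw [Matrix.coe_units_inv, Matrix.inv_def, Matrix.adjugate_fin_two]
    simp [hg]

/-- The lower right entry `(a b; 0 d) ↦ d`, a multiplicative map on `B(R)`. -/
def borelGL2LowerRight (R : Type*) [CommRing R] : borelGL2 R →* R where
  toFun g := g.val.val 1 1
  map_one' := by simp
  map_mul' g h := by
    have hg : g.val.val 1 0 = 0 := g.property
    simp [Matrix.mul_apply, Fin.sum_univ_two, hg]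

/-! ### The principal series -/

section PrincipalSeries

variable (O : Type*) [CommRing O] [IsLocalRing O]

/-- The ring `𝒪_n = 𝒪 / 𝔪ⁿ`. -/
abbrev TruncatedRing (n : ℕ) : Type _ := O ⧸ IsLocalRing.maximalIdeal O ^ n

/-- The projection `𝒪_n → k`, `λ ↦ λ₀`, for `n ≥ 1`. -/
def TruncatedRing.residue (n : ℕ) [NeZero n] :
    TruncatedRing O n →+* IsLocalRing.ResidueField O :=
  Ideal.Quotient.factor (Ideal.pow_le_self (NeZero.ne n))

/-- The character `χ_r : B_n → k^×`, `(a b; 0 d) ↦ d₀ ^ r`, for `r ∈ ℤ / (q - 1)ℤ` with `q = #k`,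
as a multiplicative map to `k`.  As `d₀ ∈ k^×`, the power depends only on the class `r`; it is
computed with the representative of `r` in `{0, …, q - 2}`. -/
noncomputable def borelCharacter (n : ℕ) [NeZero n] (r : ZMod (Nat.card (IsLocalRing.ResidueField O) - 1)) :
    borelGL2 (TruncatedRing O n) →* IsLocalRing.ResidueField O :=
  (powMonoidHom r.val).comp
    ((TruncatedRing.residue O n : TruncatedRing O n →* IsLocalRing.ResidueField O).comp
      (borelGL2LowerRight (TruncatedRing O n)))

variable (E : Type*) [Field E] [Algebra (IsLocalRing.ResidueField O) E]

/-- The character `χ_r`, viewed as a one-dimensional representation of `B_n` over `E ⊇ k`. -/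
noncomputable def borelCharacterRep (n : ℕ) [NeZero n]
    (r : ZMod (Nat.card (IsLocalRing.ResidueField O) - 1)) :
    Representation E (borelGL2 (TruncatedRing O n)) E :=
  ((Algebra.lmul E E : E →* Module.End E E).comp
    (algebraMap (IsLocalRing.ResidueField O) E : IsLocalRing.ResidueField O →* E)).comp
      (borelCharacter O n r)

/-- The principal series `V_{n,r} = Ind_{B_n}^{G_n} χ_r` over `E`, where `G_n = GL₂(𝒪_n)`: the space
of functions `φ : G_n → E` with `φ(b g) = χ_r(b) φ(g)` for all `b ∈ B_n`, on which `G_n` acts by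
right translation. -/
noncomputable def principalSeries (n : ℕ) [NeZero n]
    (r : ZMod (Nat.card (IsLocalRing.ResidueField O) - 1)) :
    Representation E (GL (Fin 2) (TruncatedRing O n))
      (Representation.coindV (borelGL2 (TruncatedRing O n)).subtype (borelCharacterRep O E n r)) :=
  Representation.coind (borelGL2 (TruncatedRing O n)).subtype (borelCharacterRep O E n r)

end PrincipalSeries

/-! ### Base `p` digits of a class modulo `q - 1` -/

/-- The digit `r_i` of a class `r ∈ ℤ / Nℤ` with `N = p ^ f - 1`: the `i`-th base `p` digit of the
representative of `r` in `{1, …, N}`, so that `r` is the class of `∑_{i < f} r_i p ^ i` with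
`0 ≤ r_i ≤ p - 1` not all zero (the zero class has all digits equal to `p - 1`). -/
def cyclicDigit (p : ℕ) {N : ℕ} (r : ZMod N) (i : ℕ) : ℕ :=
  (if r = 0 then N else r.val) / p ^ i % p

/-! As e ≥ 2, the ring 𝒪/𝔪² has characteristic p and maps onto k[ε]. The bottom row of g then yields
its reduction u ∈ k² and an invariant w ∈ k. Left multiplication by B gives u ↦ d₀u, w ↦ d₀²w; right
translation by h, with reduced determinant D, gives u ↦ uh₀, w ↦ Dw + Q(u). So w^i ψ(u) lies in the
principal series when ψ has degree r - 2i, and translating w^(p^j n) ψ(u) produces, besides the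
leading term twisted by D^(p^j n), only powers w^(p^j l) with l < n.

Write r = a + pb with a = r₀. Modulo the exponents S = {0, …, a-1} ∪ p{0, …, b-1}, the terms in w^a
and in w^(pb) form two stable layers, of opposite degrees pb - a and a - pb. The intertwining
operator T maps the first to the second, and its determinant twist D^(pb-a) is exactly the
discrepancy between the layers. Hence for each c ∈ E the graph of cT, enlarged by the exponents in
S, is stable. As T ≠ 0 and all exponents are below q, the subspace determines c
(`comp_mul_right_mem_twistedFamily`, `eq_of_twistedSum_mem_twistedFamily`). -/

/-! ### Functions polynomial in w -/

open Finset in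
/-- The functions `∑ i ∈ S, w ^ i * h i (u ·)`, polynomial in `w` with exponents in `S` and with
coefficients arbitrary functions of `u`. -/
def polySpan {G X k : Type*} (E : Type*) [Field k] [Field E] [Algebra k E] (w : G → k) (u : G → X)
    (S : Finset ℕ) : Submodule E (G → E) where
  carrier := {φ | ∃ h : ℕ → X → E, ∀ g, φ g = ∑ i ∈ S, algebraMap k E (w g) ^ i * h i (u g)}
  zero_mem' := ⟨0, by simp⟩
  add_mem' := by
    rintro φ φ' ⟨h, hφ⟩ ⟨h', hφ'⟩
    refine ⟨h + h', fun g => ?_⟩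
    simp [hφ, hφ', mul_add, sum_add_distrib]
  smul_mem' := by
    rintro c φ ⟨h, hφ⟩
    refine ⟨c • h, fun g => ?_⟩
    simp only [Pi.smul_apply, smul_eq_mul, hφ, mul_sum]
    exact sum_congr rfl fun i _ => by ring

section PolySpan

variable {G X k E : Type*} [Field k] [Field E] [Algebra k E] {w : G → k} {u : G → X}
  {S : Finset ℕ}

theorem pow_mul_mem_polySpan {i : ℕ} (hi : i ∈ S) (h : X → E) :
    (fun g => algebraMap k E (w g) ^ i * h (u g)) ∈ polySpan E w u S := by
  refine ⟨fun j => if j = i then h else 0, fun g => ?_⟩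
  rw [Finset.sum_eq_single_of_mem i hi fun j _ hj => by simp [hj]]
  simp

theorem polySpan_induction {P : (G → E) → Prop} (h0 : P 0) (hadd : ∀ φ φ', P φ → P φ' → P (φ + φ'))
    (hP : ∀ i ∈ S, ∀ h : X → E, P fun g => algebraMap k E (w g) ^ i * h (u g))
    {φ : G → E} (hφ : φ ∈ polySpan E w u S) : P φ := by
  obtain ⟨h, hφ⟩ := hφ
  have : φ = ∑ i ∈ S, fun g => algebraMap k E (w g) ^ i * h i (u g) := by
    ext g; simp [hφ]
  rw [this]
  exact Finset.sum_induction _ P hadd h0 fun i hi => hP i hi _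

theorem linear_pow_sub_mem_polySpan (s n : ℕ) (hS : ∀ i < n, s * i ∈ S) (D : k) (Q : X → k)
    (h : X → E) :
    (fun g => algebraMap k E ((D * w g ^ s + Q (u g)) ^ n) * h (u g)
      - algebraMap k E (w g) ^ (s * n) * (algebraMap k E (D ^ n) * h (u g)))
      ∈ polySpan E w u S := by
  have : (fun g => algebraMap k E ((D * w g ^ s + Q (u g)) ^ n) * h (u g)
      - algebraMap k E (w g) ^ (s * n) * (algebraMap k E (D ^ n) * h (u g))) =
      ∑ m ∈ Finset.range n, fun g => algebraMap k E (w g) ^ (s * m) *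
        ((fun x => algebraMap k E (D ^ m * Q x ^ (n - m) * n.choose m) * h x) (u g)) := by
    ext g
    rw [add_pow, Finset.sum_range_succ, Finset.sum_apply, map_add, map_sum, add_mul,
      Finset.sum_mul]
    simp only [Nat.sub_self, pow_zero, Nat.choose_self, Nat.cast_one, mul_one, mul_pow, ← pow_mul,
      map_mul, map_pow]
    rw [mul_comm (algebraMap k E D ^ n), mul_assoc _ (algebraMap k E D ^ n), add_sub_cancel_right]
    exact Finset.sum_congr rfl fun m _ => by ring
  rw [this]
  exact Submodule.sum_mem _ fun m hm =>
    pow_mul_mem_polySpan (hS m (Finset.mem_range.1 hm))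
      (fun x => algebraMap k E (D ^ m * Q x ^ (n - m) * n.choose m) * h x)

/-- A polynomial of degree below q with q roots vanishes. -/
theorem coeff_eq_zero_of_forall_sum_pow_eq_zero [Fintype k] (hS : ∀ i ∈ S, i < Fintype.card k)
    (c : ℕ → E) (hc : ∀ t : k, ∑ i ∈ S, algebraMap k E t ^ i * c i = 0) {i : ℕ} (hi : i ∈ S) :
    c i = 0 := by
  classical
  set P : Polynomial E := ∑ i ∈ S, Polynomial.C (c i) * Polynomial.X ^ i with hP
  have hdeg : P.natDegree < Fintype.card k := by
    refine (Polynomial.natDegree_sum_le _ _).trans_lt ?_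
    rw [Finset.fold_max_lt]
    exact ⟨Fintype.card_pos, fun j hj => (Polynomial.natDegree_C_mul_X_pow_le _ _).trans_lt (hS j hj)⟩
  have hP0 : P = 0 := by
    refine Polynomial.eq_zero_of_natDegree_lt_card_of_eval_eq_zero P
      (algebraMap k E).injective (fun t => ?_) hdeg
    rw [hP, Polynomial.eval_finsetSum, ← hc t]
    exact Finset.sum_congr rfl fun j _ => by
      rw [Polynomial.eval_mul, Polynomial.eval_C, Polynomial.eval_pow, Polynomial.eval_X, mul_comm]
  have := congrArg (fun p => Polynomial.coeff p i) hP0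
  simpa only [hP, Polynomial.finsetSum_coeff, Polynomial.coeff_C_mul_X_pow, Finset.sum_ite_eq,
    if_pos hi, Polynomial.coeff_zero] using this

end PolySpan

/-! ### Homogeneous functions on k² and the intertwining operator -/

/-- The functions on `k²` that are homogeneous of degree `m - n`. -/
def homogeneousFunctions (k E : Type*) [Field k] [Field E] [Algebra k E] (m n : ℕ) :
    Submodule E (k × k → E) where
  carrier := {ψ | ∀ t : k, t ≠ 0 → ∀ u,
    algebraMap k E t ^ n * ψ (t • u) = algebraMap k E t ^ m * ψ u}
  zero_mem' := by simp
  add_mem' := by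
    intro ψ ψ' h h' t ht u
    simp only [Pi.add_apply, mul_add, h t ht, h' t ht]
  smul_mem' := by
    intro c ψ h t ht u
    simp only [Pi.smul_apply, smul_eq_mul]
    rw [mul_left_comm, h t ht, mul_left_comm]

theorem comp_mem_homogeneousFunctions {k E : Type*} [Field k] [Field E] [Algebra k E] {m n : ℕ}
    {ψ : k × k → E} (hψ : ψ ∈ homogeneousFunctions k E m n) (a b c d : k) :
    (fun u : k × k => ψ (u.1 * a + u.2 * c, u.1 * b + u.2 * d)) ∈ homogeneousFunctions k E m n := by
  intro t ht u
  have := hψ t ht (u.1 * a + u.2 * c, u.1 * b + u.2 * d)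
  refine (congrArg (fun z => algebraMap k E t ^ n * ψ z) ?_).trans this
  ext <;> simp <;> ring

/-- The intertwining operator `(T ψ)(v) = ∑ ψ(u)`, over the `u ∈ k²` with `det (v, u) = 1`. -/
noncomputable def planeIntertwiner (k E : Type*) [Field k] [Fintype k] [Field E] :
    (k × k → E) →ₗ[E] (k × k → E) :=
  open Classical in
  { toFun := fun ψ v => ∑ u with v.1 * u.2 - v.2 * u.1 = (1 : k), ψ u
    map_add' := fun ψ ψ' => by ext v; simp [Finset.sum_add_distrib]
    map_smul' := fun c ψ => by ext v; simp [Finset.mul_sum] }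

section Plane

variable {k E : Type*} [Field k] [Fintype k] [Field E]

/-- A matrix of determinant D multiplies det (v, u) by D, so T commutes with it up to rescaling u by
D. -/
theorem planeIntertwiner_comp (a b c d : k) (hD : a * d - b * c ≠ 0) (ψ : k × k → E)
    (v : k × k) :
    planeIntertwiner k E (fun u => ψ (u.1 * a + u.2 * c, u.1 * b + u.2 * d)) v =
      planeIntertwiner k E (fun u => ψ ((a * d - b * c) • u))
        (v.1 * a + v.2 * c, v.1 * b + v.2 * d) := by
  classical
  set D := a * d - b * c with hDdef
  simp only [planeIntertwiner, LinearMap.coe_mk, AddHom.coe_mk]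
  refine Finset.sum_bij'
    (fun u _ => (D⁻¹ * (u.1 * a + u.2 * c), D⁻¹ * (u.1 * b + u.2 * d)))
    (fun u _ => (u.1 * d - u.2 * c, u.2 * a - u.1 * b)) ?_ ?_ ?_ ?_ ?_
  · intro u hu
    simp only [Finset.mem_filter, Finset.mem_univ, true_and] at hu ⊢
    field_simp
    linear_combination D * hu
  · intro u hu
    simp only [Finset.mem_filter, Finset.mem_univ, true_and] at hu ⊢
    linear_combination hu
  · intro u _
    ext
    · field_simp; ring
    · field_simp; ring
  · intro u _
    ext
    · field_simp; ring
    · field_simp; ring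
  · intro u _
    simp [mul_inv_cancel_left₀ hD]

variable [Algebra k E]

theorem planeIntertwiner_mem_homogeneousFunctions {m n : ℕ} {ψ : k × k → E}
    (hψ : ψ ∈ homogeneousFunctions k E m n) :
    planeIntertwiner k E ψ ∈ homogeneousFunctions k E n m := by
  classical
  intro t ht v
  simp only [planeIntertwiner, LinearMap.coe_mk, AddHom.coe_mk, Finset.mul_sum]
  refine Finset.sum_bij' (fun u _ => t • u) (fun u _ => t⁻¹ • u) ?_ ?_ ?_ ?_ ?_
  · intro u hu
    simp only [Finset.mem_filter, Finset.mem_univ, true_and, Prod.smul_fst, Prod.smul_snd,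
      smul_eq_mul] at hu ⊢
    linear_combination hu
  · intro u hu
    simp only [Finset.mem_filter, Finset.mem_univ, true_and, Prod.smul_fst, Prod.smul_snd,
      smul_eq_mul] at hu ⊢
    field_simp
    linear_combination hu
  · intro u _
    exact inv_smul_smul₀ ht u
  · intro u _
    exact smul_inv_smul₀ ht u
  · intro u _
    exact (hψ t ht u).symm

theorem exists_planeIntertwiner_ne_zero (m n : ℕ) :
    ∃ ψ ∈ homogeneousFunctions k E m n, ∃ v, v ≠ 0 ∧ planeIntertwiner k E ψ v ≠ 0 := by
  classical
  -- ψ is supported on one axis, which the line det (v, u) = 1 for v = (0, -1) meets only in (1, 0):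
  -- the sum is a single term 1.
  refine ⟨fun u => if u.2 = 0 ∧ u.1 ≠ 0 then
      (algebraMap k E u.1 ^ n)⁻¹ * algebraMap k E u.1 ^ m else 0, ?_, (0, -1), by simp, ?_⟩
  · intro t ht u
    beta_reduce
    by_cases h : u.2 = 0 ∧ u.1 ≠ 0
    · have h1 : algebraMap k E u.1 ≠ 0 := by simpa using h.2
      have h2 : algebraMap k E t ≠ 0 := by simpa using ht
      rw [if_pos h, if_pos (by simp [ht, h])]
      simp only [Prod.smul_fst, smul_eq_mul, map_mul, mul_pow]
      field_simp
    · rw [if_neg h, if_neg (by simpa [ht] using h)]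
      simp
  · simp only [planeIntertwiner, LinearMap.coe_mk, AddHom.coe_mk]
    rw [Finset.sum_eq_single (1, 0)]
    · simp
    · rintro ⟨x, y⟩ hu hne
      simp only [Finset.mem_filter, Finset.mem_univ, true_and] at hu
      have hx : x = 1 := by linear_combination hu
      rw [if_neg]
      rintro ⟨hy, -⟩
      exact hne (Prod.ext hx hy)
    · intro h
      simp at h

end Plane

/-! ### Coordinates u and w on GL₂ over k[ε] -/

section BottomRow

variable {R k : Type*} [CommRing R] [Field k] (τ : R →+* DualNumber k)

/-- The reduction `(x₀, y₀)` of the bottom row `(x₀ + ε x₁, y₀ + ε y₁)` of a matrix over `k[ε]`. -/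
def bottomRow (g : GL (Fin 2) R) : k × k := ((τ (g.val 1 0)).fst, (τ (g.val 1 1)).fst)

/-- The invariant `x₀ y₁ - x₁ y₀` of the bottom row `(x₀ + ε x₁, y₀ + ε y₁)` of a matrix over
`k[ε]`. -/
def bottomSlope (g : GL (Fin 2) R) : k :=
  (τ (g.val 1 0)).fst * (τ (g.val 1 1)).snd - (τ (g.val 1 0)).snd * (τ (g.val 1 1)).fst

theorem fst_det_ne_zero (g : GL (Fin 2) R) :
    (τ (g.val 0 0)).fst * (τ (g.val 1 1)).fst - (τ (g.val 0 1)).fst * (τ (g.val 1 0)).fst ≠ 0 := by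
  have h : IsUnit g.val.det := (Matrix.isUnit_iff_isUnit_det _).1 g.isUnit
  have h' := ((h.map τ).map (TrivSqZeroExt.fstHom k k k)).ne_zero
  simpa [Matrix.det_fin_two] using h'

theorem bottomRow_mul (g h : GL (Fin 2) R) :
    bottomRow τ (g * h) =
      ((bottomRow τ g).1 * (τ (h.val 0 0)).fst + (bottomRow τ g).2 * (τ (h.val 1 0)).fst,
        (bottomRow τ g).1 * (τ (h.val 0 1)).fst + (bottomRow τ g).2 * (τ (h.val 1 1)).fst) := by
  simp [bottomRow, Matrix.mul_apply, Fin.sum_univ_two]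

theorem exists_bottomSlope_mul (h : GL (Fin 2) R) : ∃ Q : k × k → k, ∀ g, bottomSlope τ (g * h) =
    ((τ (h.val 0 0)).fst * (τ (h.val 1 1)).fst - (τ (h.val 0 1)).fst * (τ (h.val 1 0)).fst) *
      bottomSlope τ g + Q (bottomRow τ g) := by
  obtain ⟨a₀, ha₀⟩ : ∃ x, x = (τ (h.val 0 0)).fst := ⟨_, rfl⟩
  obtain ⟨a₁, ha₁⟩ : ∃ x, x = (τ (h.val 0 0)).snd := ⟨_, rfl⟩
  obtain ⟨b₀, hb₀⟩ : ∃ x, x = (τ (h.val 0 1)).fst := ⟨_, rfl⟩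
  obtain ⟨b₁, hb₁⟩ : ∃ x, x = (τ (h.val 0 1)).snd := ⟨_, rfl⟩
  obtain ⟨c₀, hc₀⟩ : ∃ x, x = (τ (h.val 1 0)).fst := ⟨_, rfl⟩
  obtain ⟨c₁, hc₁⟩ : ∃ x, x = (τ (h.val 1 0)).snd := ⟨_, rfl⟩
  obtain ⟨d₀, hd₀⟩ : ∃ x, x = (τ (h.val 1 1)).fst := ⟨_, rfl⟩
  obtain ⟨d₁, hd₁⟩ : ∃ x, x = (τ (h.val 1 1)).snd := ⟨_, rfl⟩
  refine ⟨fun u => u.1 ^ 2 * (a₀ * b₁ - a₁ * b₀) + u.2 ^ 2 * (c₀ * d₁ - c₁ * d₀)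
    + u.1 * u.2 * (a₀ * d₁ + c₀ * b₁ - a₁ * d₀ - c₁ * b₀), fun g => ?_⟩
  simp only [bottomSlope, bottomRow, Units.val_mul, Matrix.mul_apply, Fin.sum_univ_two, map_add,
    map_mul, TrivSqZeroExt.fst_add, TrivSqZeroExt.snd_add, TrivSqZeroExt.fst_mul,
    TrivSqZeroExt.snd_mul, smul_eq_mul, MulOpposite.smul_eq_mul_unop, MulOpposite.unop_op,
    ← ha₀, ← ha₁, ← hb₀, ← hb₁, ← hc₀, ← hc₁, ← hd₀, ← hd₁]
  ring

theorem bottomRow_borel_mul (b : borelGL2 R) (g : GL (Fin 2) R) :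
    bottomRow τ (b.val * g) = (τ (b.val.val 1 1)).fst • bottomRow τ g := by
  have hb : b.val.val 1 0 = 0 := b.property
  ext <;> simp [bottomRow, Matrix.mul_apply, Fin.sum_univ_two, hb]

theorem bottomSlope_borel_mul (b : borelGL2 R) (g : GL (Fin 2) R) :
    bottomSlope τ (b.val * g) = (τ (b.val.val 1 1)).fst ^ 2 * bottomSlope τ g := by
  have hb : b.val.val 1 0 = 0 := b.property
  simp [bottomSlope, Matrix.mul_apply, Fin.sum_univ_two, hb]
  ring

theorem fst_borel_ne_zero (b : borelGL2 R) : (τ (b.val.val 1 1)).fst ≠ 0 := by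
  have hb : b.val.val 1 0 = 0 := b.property
  intro h
  exact fst_det_ne_zero τ b.val (by rw [h, hb]; simp)

/-- Over each u ≠ 0 the invariant w takes all values in k, which is what allows coefficients of
powers of w to be compared. -/
theorem exists_bottomRow_bottomSlope (hunit : ∀ x : R, (τ x).fst ≠ 0 → IsUnit x)
    (hτ : Function.Surjective τ) (v : k × k) (hv : v ≠ 0) (t : k) :
    ∃ g : GL (Fin 2) R, bottomRow τ g = v ∧ bottomSlope τ g = t := by
  obtain ⟨x, y⟩ := v
  obtain ⟨x', y', hxy⟩ : ∃ x' y' : k, x' * y - y' * x = 1 := by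
    by_cases hx : x = 0
    · have hy : y ≠ 0 := fun hy => hv (by rw [hx, hy]; rfl)
      exact ⟨y⁻¹, 0, by field_simp; ring⟩
    · exact ⟨0, -x⁻¹, by field_simp; ring⟩
  obtain ⟨X, hX⟩ := hτ (TrivSqZeroExt.inl x + TrivSqZeroExt.inr (-x' * t))
  obtain ⟨Y, hY⟩ := hτ (TrivSqZeroExt.inl y + TrivSqZeroExt.inr (-y' * t))
  obtain ⟨X', hX'⟩ := hτ (TrivSqZeroExt.inl x')
  obtain ⟨Y', hY'⟩ := hτ (TrivSqZeroExt.inl y')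
  have hdet : IsUnit (!![X', Y'; X, Y] : Matrix (Fin 2) (Fin 2) R).det := by
    refine hunit _ ?_
    simp [Matrix.det_fin_two, hX, hY, hX', hY', hxy]
  obtain ⟨g, hg⟩ := (Matrix.isUnit_iff_isUnit_det _).2 hdet
  refine ⟨g, ?_, ?_⟩
  · simp [bottomRow, hg, hX, hY]
  · simp [bottomSlope, hg, hX, hY]
    linear_combination t * hxy

end BottomRow

/-! ### The family of stable subspaces indexed by c -/

section Family

variable {R k E : Type*} [CommRing R] [Field k] [Field E] [Algebra k E]
  (τ : R →+* DualNumber k)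

/-- The function `g ↦ w ^ m * ψ(u) + c * w ^ n * (T ψ)(u)`, where `u` is the reduction of the
bottom row of `g`, `w` is its invariant and `T` is the intertwining operator. -/
noncomputable def twistedSum [Fintype k] (m n : ℕ) (c : E) : (k × k → E) →ₗ[E] (GL (Fin 2) R → E) where
  toFun ψ g := algebraMap k E (bottomSlope τ g) ^ m * ψ (bottomRow τ g) +
    algebraMap k E (bottomSlope τ g) ^ n * (c * planeIntertwiner k E ψ (bottomRow τ g))
  map_add' ψ ψ' := by
    ext g
    simp only [map_add, Pi.add_apply]
    ring
  map_smul' a ψ := by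
    ext g
    simp only [map_smul, Pi.smul_apply, smul_eq_mul, RingHom.id_apply]
    ring

/-- The sum of the space of functions `w ^ m * ψ(u) + c * w ^ n * (T ψ)(u)`, with `ψ` homogeneous,
and of the space of functions polynomial in `w` with exponents in `S`. -/
noncomputable def twistedFamily [Fintype k] (S : Finset ℕ) (m n : ℕ) (c : E) :
    Submodule E (GL (Fin 2) R → E) :=
  (homogeneousFunctions k E n m).map (twistedSum τ m n c) ⊔
    polySpan E (bottomSlope τ) (bottomRow τ) S

variable {τ}

/-- By Frobenius, (Dw + Q)^(p^j n) is a polynomial of degree n in w^(p^j), so only its leading term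
can leave the span. -/
theorem pow_mul_right_sub_mem_polySpan {p : ℕ} [ExpChar k p] {S : Finset ℕ} (j n : ℕ)
    (hS : ∀ l < n, p ^ j * l ∈ S) (ψ : k × k → E) (h : GL (Fin 2) R) :
    (fun g => algebraMap k E (bottomSlope τ (g * h)) ^ (p ^ j * n) * ψ (bottomRow τ (g * h)) -
      algebraMap k E (bottomSlope τ g) ^ (p ^ j * n) *
        (algebraMap k E ((τ (h.val 0 0)).fst * (τ (h.val 1 1)).fst -
          (τ (h.val 0 1)).fst * (τ (h.val 1 0)).fst) ^ (p ^ j * n) * ψ (bottomRow τ (g * h))))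
      ∈ polySpan E (bottomSlope τ) (bottomRow τ) S := by
  obtain ⟨Q, hQ⟩ := exists_bottomSlope_mul τ h
  set D := (τ (h.val 0 0)).fst * (τ (h.val 1 1)).fst - (τ (h.val 0 1)).fst * (τ (h.val 1 0)).fst
  convert linear_pow_sub_mem_polySpan (w := bottomSlope τ) (u := bottomRow τ) (p ^ j) n hS
    (D ^ p ^ j) (fun u => Q u ^ p ^ j) (fun u => ψ (u.1 * (τ (h.val 0 0)).fst +
      u.2 * (τ (h.val 1 0)).fst, u.1 * (τ (h.val 0 1)).fst + u.2 * (τ (h.val 1 1)).fst))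
    using 2 with g
  rw [hQ, bottomRow_mul, pow_mul, ← map_pow, add_pow_expChar_pow, mul_pow]
  simp only [map_pow, pow_mul]

theorem comp_mul_right_mem_polySpan {p : ℕ} [ExpChar k p] {S : Finset ℕ}
    (hS : ∀ i ∈ S, ∃ j n, i = p ^ j * n ∧ ∀ l < n, p ^ j * l ∈ S) {φ : GL (Fin 2) R → E}
    (hφ : φ ∈ polySpan E (bottomSlope τ) (bottomRow τ) S) (h : GL (Fin 2) R) :
    (fun g => φ (g * h)) ∈ polySpan E (bottomSlope τ) (bottomRow τ) S := by
  refine polySpan_induction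
    (P := fun φ => (fun g => φ (g * h)) ∈ polySpan E (bottomSlope τ) (bottomRow τ) S)
    (zero_mem _) (fun φ φ' hφ hφ' => add_mem hφ hφ') (fun i hi ψ => ?_) hφ
  obtain ⟨j, n, rfl, hl⟩ := hS i hi
  rw [← Submodule.sub_mem_iff_left _ (pow_mul_mem_polySpan hi fun u =>
    algebraMap k E ((τ (h.val 0 0)).fst * (τ (h.val 1 1)).fst -
      (τ (h.val 0 1)).fst * (τ (h.val 1 0)).fst) ^ (p ^ j * n) *
      ψ (u.1 * (τ (h.val 0 0)).fst + u.2 * (τ (h.val 1 0)).fst,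
        u.1 * (τ (h.val 0 1)).fst + u.2 * (τ (h.val 1 1)).fst))]
  convert pow_mul_right_sub_mem_polySpan j n hl ψ h using 2 with g
  simp only [Pi.sub_apply, bottomRow_mul]

theorem comp_mul_right_mem_twistedFamily [Fintype k] {p : ℕ} [ExpChar k p] {S : Finset ℕ}
    (hS : ∀ i ∈ S, ∃ j n, i = p ^ j * n ∧ ∀ l < n, p ^ j * l ∈ S) {m n i j : ℕ}
    (hm : ∀ l < m, p ^ i * l ∈ S) (hn : ∀ l < n, p ^ j * l ∈ S) {c : E} {φ : GL (Fin 2) R → E}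
    (hφ : φ ∈ twistedFamily τ S (p ^ i * m) (p ^ j * n) c) (h : GL (Fin 2) R) :
    (fun g => φ (g * h)) ∈ twistedFamily τ S (p ^ i * m) (p ^ j * n) c := by
  obtain ⟨_, ⟨ψ, hψ, rfl⟩, φ₀, hφ₀, rfl⟩ := Submodule.mem_sup.1 hφ
  have hD := fst_det_ne_zero τ h
  have h1 := pow_mul_right_sub_mem_polySpan (τ := τ) i m hm ψ h
  have h2 := pow_mul_right_sub_mem_polySpan (τ := τ) j n hn (c • planeIntertwiner k E ψ) h
  have hrow := fun g => bottomRow_mul τ g h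
  have hcomp := planeIntertwiner_comp (τ (h.val 0 0)).fst (τ (h.val 0 1)).fst (τ (h.val 1 0)).fst
    (τ (h.val 1 1)).fst hD ψ
  set D := (τ (h.val 0 0)).fst * (τ (h.val 1 1)).fst - (τ (h.val 0 1)).fst * (τ (h.val 1 0)).fst
  refine Submodule.mem_sup.2 ⟨_, ⟨_, Submodule.smul_mem _ (algebraMap k E D ^ (p ^ i * m))
    (comp_mem_homogeneousFunctions hψ (τ (h.val 0 0)).fst (τ (h.val 0 1)).fst
      (τ (h.val 1 0)).fst (τ (h.val 1 1)).fst), rfl⟩, _,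
    add_mem (add_mem h1 h2) (comp_mul_right_mem_polySpan hS hφ₀ h), ?_⟩
  -- Homogeneity turns the rescaling by D in `planeIntertwiner_comp` into the ratio of the
  -- determinant twists of the two layers, so c is unchanged.
  have hhom : (fun u => ψ (D • u)) = (algebraMap k E D ^ (p ^ i * m))⁻¹ •
      algebraMap k E D ^ (p ^ j * n) • ψ := by
    ext u
    have hD' : algebraMap k E D ≠ 0 := by simpa using hD
    simp only [Pi.smul_apply, smul_eq_mul, ← hψ D hD u]
    field_simp
  ext g
  have hD' : algebraMap k E D ^ (p ^ i * m) ≠ 0 := pow_ne_zero _ (by simpa using hD)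
  simp only [twistedSum, LinearMap.coe_mk, AddHom.coe_mk, map_smul, Pi.smul_apply, Pi.add_apply,
    smul_eq_mul, hcomp, hhom, hrow]
  field_simp
  ring

theorem eq_of_twistedSum_mem_twistedFamily [Fintype k]
    (hτ : Function.Surjective τ) (hunit : ∀ x : R, (τ x).fst ≠ 0 → IsUnit x) {S : Finset ℕ} {m n : ℕ}
    (hS : ∀ i ∈ S, i < Fintype.card k) (hm : m < Fintype.card k) (hn : n < Fintype.card k)
    (hmS : m ∉ S) (hnS : n ∉ S) (hmn : m ≠ n) {c c' : E} {ψ : k × k → E} {v : k × k} (hv : v ≠ 0)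
    (hψv : planeIntertwiner k E ψ v ≠ 0)
    (hmem : twistedSum τ m n c ψ ∈ twistedFamily τ S m n c') : c = c' := by
  obtain ⟨_, ⟨ψ', -, rfl⟩, φ, ⟨h, hφ⟩, heq⟩ := Submodule.mem_sup.1 hmem
  have key : ∀ v ≠ 0, ψ' v = ψ v ∧
      c' * planeIntertwiner k E ψ' v = c * planeIntertwiner k E ψ v := by
    intro v hv
    have hcoeff := fun i (hi : i ∈ insert m (insert n S)) =>
      coeff_eq_zero_of_forall_sum_pow_eq_zero (S := insert m (insert n S)) (k := k) (by
      simp only [Finset.mem_insert]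
      rintro i (rfl | rfl | hi)
      exacts [hm, hn, hS i hi])
      (fun i => if i = m then ψ' v - ψ v else if i = n then
        c' * planeIntertwiner k E ψ' v - c * planeIntertwiner k E ψ v else h i v) (fun t => by
      obtain ⟨g, rfl, rfl⟩ := exists_bottomRow_bottomSlope τ hunit hτ v hv t
      rw [Finset.sum_insert (by simp [hmS, hmn]), Finset.sum_insert hnS,
        Finset.sum_congr rfl fun i hi => by
          rw [if_neg (ne_of_mem_of_not_mem hi hmS), if_neg (ne_of_mem_of_not_mem hi hnS)], ← hφ]
      have := congrFun heq g
      simp only [twistedSum, LinearMap.coe_mk, AddHom.coe_mk, Pi.add_apply] at this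
      rw [if_pos rfl, if_neg hmn.symm, if_pos rfl]
      linear_combination this) hi
    have h1 := hcoeff m (by simp)
    have h2 := hcoeff n (by simp)
    rw [if_pos rfl] at h1
    rw [if_neg hmn.symm, if_pos rfl] at h2
    exact ⟨sub_eq_zero.1 h1, sub_eq_zero.1 h2⟩
  -- ψ' and ψ are compared only away from 0, but u = 0 never satisfies det (v, u) = 1.
  have hT : planeIntertwiner k E ψ' v = planeIntertwiner k E ψ v := by
    simp only [planeIntertwiner, LinearMap.coe_mk, AddHom.coe_mk]
    refine Finset.sum_congr rfl fun u hu => (key u ?_).1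
    rintro rfl
    simp at hu
  have := (key v hv).2
  rw [hT] at this
  exact (mul_right_cancel₀ hψv this).symm

end Family

/-! ### Identification with the dual numbers -/

/-- In characteristic p the map x ↦ x^q is a ring endomorphism lifting the identity of k. Writing x
- x^q = ε y(x), the reduction of y is a derivation over ρ with value 1 at ε, and it serves as the
ε-coefficient. -/
theorem exists_dualNumber_hom {R k : Type*} [CommRing R] [Field k] (p f : ℕ) [Fact p.Prime]
    [CharP R p] [Fintype k] (hf : Fintype.card k = p ^ f) (ρ : R →+* k)
    (hρ : Function.Surjective ρ) (hunit : ∀ x, ρ x ≠ 0 → IsUnit x) (ε : R) (hε0 : ε ≠ 0)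
    (hε : ρ ε = 0) (hε2 : ε ^ 2 = 0) (hker : ∀ x, ρ x = 0 → ∃ y, x = ε * y) :
    ∃ τ : R →+* DualNumber k, Function.Surjective τ ∧ ∀ x, (τ x).fst = ρ x := by
  have hpow : ∀ x, ρ (x ^ p ^ f) = ρ x := fun x => by rw [map_pow, ← hf, FiniteField.pow_card]
  have hy : ∀ x, ∃ y, x - x ^ p ^ f = ε * y := fun x => hker _ (by rw [map_sub, hpow, sub_self])
  choose y hy using hy
  have huniq : ∀ a b, ε * a = ε * b → ρ a = ρ b := by
    intro a b hab
    by_contra h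
    have hu := hunit (a - b) (by rwa [map_sub, sub_ne_zero])
    exact hε0 ((hu.mul_left_eq_zero).1 (by rw [mul_sub, hab, sub_self]))
  have hy1 : ρ (y 1) = 0 := by
    rw [← map_zero ρ]
    exact huniq _ _ (by rw [← hy]; simp)
  have hy0 : ρ (y 0) = 0 := by
    rw [← map_zero ρ]
    exact huniq _ _ (by rw [← hy, zero_pow (hf ▸ Fintype.card_ne_zero)]; simp)
  have hyadd : ∀ a b, ρ (y (a + b)) = ρ (y a) + ρ (y b) := fun a b => by
    rw [← map_add ρ]
    exact huniq _ _ (by rw [mul_add, ← hy, ← hy, ← hy, add_pow_expChar_pow]; ring)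
  have hymul : ∀ a b, ρ (y (a * b)) = ρ a * ρ (y b) + ρ (y a) * ρ b := fun a b => by
    -- With a^q in place of a, this is the identity ab - a^q b^q = a^q (b - b^q) + (a - a^q) b.
    rw [← hpow a, ← map_mul, ← map_mul, ← map_add]
    refine huniq _ _ ?_
    rw [mul_add, ← hy, mul_left_comm, ← hy, ← mul_assoc, ← hy]
    ring
  have hyε : ρ (y ε) = 1 := by
    rw [← map_one ρ]
    refine huniq _ _ ?_
    have h2 : 2 ≤ p ^ f := hf ▸ Fintype.one_lt_card
    rw [← hy, pow_eq_zero_of_le h2 hε2, sub_zero, mul_one]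
  let τ : R →+* DualNumber k :=
    { toFun := fun x => TrivSqZeroExt.inl (ρ x) + TrivSqZeroExt.inr (ρ (y x))
      map_zero' := by ext <;> simp [hy0]
      map_one' := by ext <;> simp [hy1]
      map_add' := fun a b => by ext <;> simp [hyadd]
      map_mul' := fun a b => by ext <;> simp [hymul, mul_comm] }
  have hfst : ∀ x, (τ x).fst = ρ x := fun x => by simp [τ]
  have hsnd : ∀ x, (τ x).snd = ρ (y x) := fun x => by simp [τ]
  refine ⟨τ, fun z => ?_, hfst⟩
  obtain ⟨x, hx⟩ := hρ z.fst
  obtain ⟨t, ht⟩ := hρ (z.snd - ρ (y x))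
  refine ⟨x + ε * t, ?_⟩
  ext
  · rw [hfst, map_add, map_mul, hε, hx, zero_mul, add_zero]
  · rw [hsnd, hyadd, hymul, hε, hyε, ht]
    ring

/-! ### Submodules of the principal series -/

section PrincipalSeries

variable {O : Type*} [CommRing O] [IsLocalRing O] {E : Type*} [Field E]
  [Algebra (IsLocalRing.ResidueField O) E]

open IsLocalRing

theorem TruncatedRing.residue_surjective (n : ℕ) [NeZero n] :
    Function.Surjective (TruncatedRing.residue O n) :=
  Ideal.Quotient.factor_surjective _

theorem TruncatedRing.residue_mk (n : ℕ) [NeZero n] (x : O) :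
    TruncatedRing.residue O n (Ideal.Quotient.mk _ x) = IsLocalRing.residue O x := rfl

theorem TruncatedRing.isUnit_of_residue_ne_zero (n : ℕ) [NeZero n] (x : TruncatedRing O n)
    (hx : TruncatedRing.residue O n x ≠ 0) : IsUnit x := by
  obtain ⟨x, rfl⟩ := Ideal.Quotient.mk_surjective x
  rw [residue_mk, IsLocalRing.residue_ne_zero_iff_isUnit] at hx
  exact hx.map _

/-- Both terms have total weight m + n in d₀: 2m + (n - m) and 2n + (m - n). -/
theorem mem_coindV_of_bottomRow [Fintype (ResidueField O)]
    {τ : TruncatedRing O 2 →+* DualNumber (ResidueField O)}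
    (hfst : ∀ x, (τ x).fst = TruncatedRing.residue O 2 x)
    (r : ZMod (Nat.card (ResidueField O) - 1)) {m n : ℕ}
    (hmn : m + n = if r = 0 then Nat.card (ResidueField O) - 1 else r.val) (c : E)
    {ψ : ResidueField O × ResidueField O → E}
    (hψ : ψ ∈ homogeneousFunctions (ResidueField O) E n m) :
    twistedSum τ m n c ψ ∈ Representation.coindV (borelGL2 (TruncatedRing O 2)).subtype
      (borelCharacterRep O E 2 r) := by
  intro b g
  have hd := fst_borel_ne_zero τ b
  have hchar : borelCharacterRep O E 2 r b (twistedSum τ m n c ψ g) =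
      algebraMap _ E (τ (b.val.val 1 1)).fst ^ (m + n) * twistedSum τ m n c ψ g := by
    have : (τ (b.val.val 1 1)).fst ^ r.val = (τ (b.val.val 1 1)).fst ^ (m + n) := by
      rw [hmn]
      split_ifs with hr
      · rw [hr, ZMod.val_zero, pow_zero, Nat.card_eq_fintype_card,
          FiniteField.pow_card_sub_one_eq_one _ hd]
      · rfl
    rw [← map_pow, ← this, hfst]
    rfl
  rw [hchar]
  have h1 := hψ _ hd (bottomRow τ g)
  have h2 := planeIntertwiner_mem_homogeneousFunctions hψ _ hd (bottomRow τ g)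
  simp only [twistedSum, LinearMap.coe_mk, AddHom.coe_mk, Subgroup.coe_subtype,
    bottomRow_borel_mul, bottomSlope_borel_mul, map_mul, map_pow] at h1 h2 ⊢
  set d := algebraMap (ResidueField O) E (τ (b.val.val 1 1)).fst
  set w := algebraMap (ResidueField O) E (bottomSlope τ g)
  linear_combination d ^ m * w ^ m * h1 + d ^ n * w ^ n * c * h2

theorem infinite_subrepresentation_principalSeries {p : ℕ} [Fact p.Prime]
    [Fintype (ResidueField O)] [ExpChar (ResidueField O) p] [Infinite E]
    {τ : TruncatedRing O 2 →+* DualNumber (ResidueField O)} (hτ : Function.Surjective τ)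
    (hfst : ∀ x, (τ x).fst = TruncatedRing.residue O 2 x)
    (r : ZMod (Nat.card (ResidueField O) - 1)) {a b : ℕ} (ha : 0 < a) (hap : a < p) (hb : 0 < b)
    (hbp : p * b < Nat.card (ResidueField O))
    (hab : a + p * b = if r = 0 then Nat.card (ResidueField O) - 1 else r.val) :
    Infinite (Subrepresentation (principalSeries O E 2 r)) := by
  classical
  have hp : 0 < p := ha.trans hap
  rw [Nat.card_eq_fintype_card] at hbp
  let S : Finset ℕ := Finset.range a ∪ (Finset.range b).image (p * ·)
  have hS1 : ∀ i < a, p ^ 0 * i ∈ S := fun i hi => by simp [S, hi]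
  have hS2 : ∀ i < b, p ^ 1 * i ∈ S := fun i hi => by
    rw [pow_one]
    exact Finset.mem_union_right _ (Finset.mem_image_of_mem _ (Finset.mem_range.2 hi))
  have hmem : ∀ i ∈ S, i < a ∨ ∃ l < b, p * l = i := fun i hi => by simpa [S] using hi
  have hS : ∀ i ∈ S, ∃ j n, i = p ^ j * n ∧ ∀ l < n, p ^ j * l ∈ S := by
    intro i hi
    rcases hmem i hi with h | ⟨l, h, rfl⟩
    · exact ⟨0, i, by simp, fun l hl => hS1 l (hl.trans h)⟩
    · exact ⟨1, l, by simp, fun l' hl => hS2 l' (hl.trans h)⟩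
  have hpb : p ≤ p * b := Nat.le_mul_of_pos_right p hb
  have hlt : ∀ i ∈ S, i < Fintype.card (ResidueField O) := by
    intro i hi
    rcases hmem i hi with h | ⟨l, h, rfl⟩
    · omega
    · exact (Nat.mul_lt_mul_of_pos_left h hp).trans hbp
  have haS : p ^ 0 * a ∉ S := by
    rw [pow_zero, one_mul]
    intro h
    rcases hmem a h with h | ⟨l, -, h⟩
    · exact h.false
    · rcases l.eq_zero_or_pos with rfl | hl
      · omega
      · exact absurd (Nat.le_mul_of_pos_right p hl) (by omega)
  have hbS : p ^ 1 * b ∉ S := by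
    rw [pow_one]
    intro h
    rcases hmem _ h with h | ⟨l, hl, h⟩
    · omega
    · exact hl.ne (Nat.eq_of_mul_eq_mul_left hp h)
  -- The family lives in all functions on the group; intersecting with the principal series keeps it
  -- stable.
  let U : E → Subrepresentation (principalSeries O E 2 r) := fun c =>
    { toSubmodule := (twistedFamily τ S (p ^ 0 * a) (p ^ 1 * b) c).comap (Submodule.subtype _)
      apply_mem_toSubmodule := fun g φ hφ =>
        comp_mul_right_mem_twistedFamily hS hS1 hS2 (Submodule.mem_comap.1 hφ) g }
  refine Infinite.of_injective U fun c c' hcc => ?_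
  obtain ⟨ψ, hψ, v, hv, hψv⟩ := exists_planeIntertwiner_ne_zero (k := ResidueField O) (E := E)
    (p ^ 1 * b) (p ^ 0 * a)
  have hcoind := mem_coindV_of_bottomRow hfst r (by simpa using hab) c hψ
  have h1 : (⟨_, hcoind⟩ : Representation.coindV _ _) ∈ (U c).toSubmodule :=
    Submodule.mem_comap.2 (Submodule.mem_sup_left (Submodule.mem_map_of_mem hψ))
  rw [hcc] at h1
  refine eq_of_twistedSum_mem_twistedFamily hτ (fun x hx => ?_) hlt ?_ ?_ haS hbS ?_ hv hψv
    (Submodule.mem_comap.1 h1)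
  · exact TruncatedRing.isUnit_of_residue_ne_zero 2 x (hfst x ▸ hx)
  all_goals simp only [pow_zero, one_mul, pow_one]; omega

end PrincipalSeries

/-! ### Ramified valuation rings and the conclusion -/

/-- If 𝔪 = 𝔪², then 𝔪 = (x) = (x²), making x a unit. Otherwise any ϖ ∈ 𝔪 outside 𝔪² generates: if ϖ
= yz with y ∈ 𝔪, then z must be a unit. -/
theorem exists_span_singleton_of_maximalIdeal_pow {A : Type*} [CommRing A] [IsDomain A]
    [ValuationRing A] {x : A} (hx : x ≠ 0) {e : ℕ} (he : 2 ≤ e)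
    (h : Ideal.span {x} = IsLocalRing.maximalIdeal A ^ e) :
    ∃ ϖ, ϖ ∉ IsLocalRing.maximalIdeal A ^ 2 ∧ IsLocalRing.maximalIdeal A = Ideal.span {ϖ} := by
  set m := IsLocalRing.maximalIdeal A with hm
  by_cases hmm : m ≤ m ^ 2
  · exfalso
    have hsq : m ^ 2 = m := le_antisymm (Ideal.pow_le_self two_ne_zero) hmm
    have hpow : ∀ n, m ^ (n + 1) = m := by
      intro n
      induction n with
      | zero => simp
      | succ n ih => rw [pow_succ, ih, ← sq, hsq]
    obtain ⟨n, rfl⟩ : ∃ n, e = n + 1 := ⟨e - 1, by omega⟩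
    rw [hpow] at h
    rw [← h, Ideal.span_singleton_pow, Ideal.span_singleton_eq_span_singleton] at hsq
    have hxm : x ∈ m := h ▸ Ideal.mem_span_singleton_self x
    obtain ⟨u, hu⟩ := hsq
    refine (IsLocalRing.mem_maximalIdeal x).1 hxm (.of_mul_eq_one u.val (mul_left_cancel₀ hx ?_))
    rw [← mul_assoc, ← sq, hu, mul_one]
  · obtain ⟨ϖ, h1, h2⟩ := Set.not_subset.1 hmm
    refine ⟨ϖ, h2, le_antisymm (fun y hy => ?_) ((Ideal.span_singleton_le_iff_mem _).2 h1)⟩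
    rw [Ideal.mem_span_singleton]
    rcases ValuationRing.dvd_total ϖ y with hd | ⟨z, rfl⟩
    · exact hd
    · by_cases hz : IsUnit z
      · exact hz.mul_right_dvd.2 dvd_rfl
      · exact absurd (sq m ▸ Ideal.mul_mem_mul hy ((IsLocalRing.mem_maximalIdeal z).2 hz)) h2

theorem infinite_subrepresentation_principalSeries_of_ramified {A : Type*} [CommRing A]
    [IsDomain A] [ValuationRing A] (p : ℕ) [Fact p.Prime] (hpA : (p : A) ≠ 0) (e f : ℕ)
    (he : Ideal.span {(p : A)} = IsLocalRing.maximalIdeal A ^ e)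
    (hf : Nat.card (IsLocalRing.ResidueField A) = p ^ f) (he2 : 2 ≤ e)
    (E : Type*) [Field E] [Algebra (IsLocalRing.ResidueField A) E] [Infinite E]
    (r : ZMod (Nat.card (IsLocalRing.ResidueField A) - 1))
    (h0 : 1 ≤ cyclicDigit p r 0) (h1 : 1 ≤ cyclicDigit p r 1) :
    Infinite (Subrepresentation (principalSeries A E 2 r)) := by
  have hp : p.Prime := Fact.out
  have : Finite (IsLocalRing.ResidueField A) :=
    Nat.finite_of_card_ne_zero (hf ▸ (pow_pos hp.pos f).ne')
  have := Fintype.ofFinite (IsLocalRing.ResidueField A)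
  obtain ⟨ϖ, hϖ2, hϖ⟩ := exists_span_singleton_of_maximalIdeal_pow hpA he2 he
  have hp0 : (p : TruncatedRing A 2) = 0 := by
    have h1 : (p : A) ∈ IsLocalRing.maximalIdeal A ^ 2 :=
      Ideal.pow_le_pow_right he2 (he ▸ Ideal.mem_span_singleton_self _)
    rw [← Ideal.Quotient.eq_zero_iff_mem] at h1
    simpa using h1
  have : Nontrivial (TruncatedRing A 2) := (TruncatedRing.residue A 2).domain_nontrivial
  have : CharP (TruncatedRing A 2) p := (CharP.charP_iff_prime_eq_zero hp).2 hp0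
  have : CharP (IsLocalRing.ResidueField A) p := (CharP.charP_iff_prime_eq_zero hp).2 <| by
    rw [← map_natCast (TruncatedRing.residue A 2), hp0, map_zero]
  have hm : ϖ ∈ IsLocalRing.maximalIdeal A := hϖ ▸ Ideal.mem_span_singleton_self ϖ
  obtain ⟨τ, hτ, hfst⟩ := exists_dualNumber_hom p f (by rw [← Nat.card_eq_fintype_card, hf])
    (TruncatedRing.residue A 2) (TruncatedRing.residue_surjective 2)
    (TruncatedRing.isUnit_of_residue_ne_zero 2) (Ideal.Quotient.mk _ ϖ)
    (by rwa [ne_eq, Ideal.Quotient.eq_zero_iff_mem])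
    (by rwa [TruncatedRing.residue_mk, IsLocalRing.residue_eq_zero_iff])
    (by rw [← map_pow, Ideal.Quotient.eq_zero_iff_mem]; exact Ideal.pow_mem_pow hm 2)
    (fun x hx => by
      obtain ⟨x, rfl⟩ := Ideal.Quotient.mk_surjective x
      rw [TruncatedRing.residue_mk, IsLocalRing.residue_eq_zero_iff, hϖ,
        Ideal.mem_span_singleton] at hx
      obtain ⟨y, rfl⟩ := hx
      exact ⟨Ideal.Quotient.mk _ y, map_mul _ _ _⟩)
  simp only [cyclicDigit, pow_zero, Nat.div_one, pow_one] at h0 h1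
  have hN : (if r = 0 then Nat.card (IsLocalRing.ResidueField A) - 1 else r.val) <
      Nat.card (IsLocalRing.ResidueField A) := by
    have hcard : 1 < Nat.card (IsLocalRing.ResidueField A) := Finite.one_lt_card
    have : NeZero (Nat.card (IsLocalRing.ResidueField A) - 1) := ⟨by omega⟩
    have := ZMod.val_lt r
    split_ifs <;> omega
  -- Here a is the digit r₀ and pb collects the remaining digits; b > 0 because r₁ ≥ 1.
  refine infinite_subrepresentation_principalSeries (p := p) hτ hfst r (a := _ % p) (b := _ / p)
    h0 (Nat.mod_lt _ hp.pos) ?_ ((Nat.mul_div_le _ p).trans_lt hN) (Nat.mod_add_div _ p)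
  by_contra h
  rw [Nat.eq_zero_of_not_pos h] at h1
  simp at h1

theorem mainTheorem8 (p : ℕ) [Fact p.Prime]
    (F : Type*) [Field F] [Algebra ℚ_[p] F] [FiniteDimensional ℚ_[p] F]
    (e f : ℕ)
    (he : Ideal.span {(p : padicValuationRing p F)} =
      IsLocalRing.maximalIdeal (padicValuationRing p F) ^ e)
    (hf : Nat.card (IsLocalRing.ResidueField (padicValuationRing p F)) = p ^ f)
    (he2 : 2 ≤ e) (hf2 : 2 ≤ f)
    (E : Type*) [Field E] [Algebra (IsLocalRing.ResidueField (padicValuationRing p F)) E]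
    [Infinite E]
    (r : ZMod (Nat.card (IsLocalRing.ResidueField (padicValuationRing p F)) - 1))
    (hr : ∀ i < f, 1 ≤ cyclicDigit p r i ∧ cyclicDigit p r i ≤ p - 2) :
    Infinite (Subrepresentation (principalSeries (padicValuationRing p F) E 2 r)) := by
  have : CharZero F := charZero_of_injective_algebraMap (algebraMap ℚ_[p] F).injective
  have hpA : (p : padicValuationRing p F) ≠ 0 := by
    intro h
    have h' := congrArg (padicValuationRing p F).subtype h
    rw [map_natCast, map_zero, Nat.cast_eq_zero] at h'
    exact (Fact.out : p.Prime).ne_zero h'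
  exact infinite_subrepresentation_principalSeries_of_ramified p hpA e f he hf he2 E r
    (hr 0 (by omega)).1 (hr 1 (by omega)).1
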